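/- Let $f\in\mathbb C[[t]]$ with $f(0)=0$ and $f'(0)\neq 0$. A system of fractional iterates of $f$ is a family $(f^s)_{s\in\mathbb C}$ of formal power series with $f^s(0)=0$, $f^1=f$ and $f^{r+s}=f^r\circ f^s$ for all $r,s\in\mathbb C$, whose coefficients are differentiable in $s$ at $s=0$; its iterative logarithm is $\operatorname{itlog}(f):=\frac{d}{ds}f^s\big|_{s=0}$ (coefficientwise). For $g(t)=\sum_k g_kt^k$ let $g(D)=\sum_k g_kD^k$ on $\mathbb C[x]$, with $D=d/dx$, and let $\mathbf x$ be multiplication by $x$. An operator $\phi$ on $\mathbb C[x]$ is the umbral operator generated by $f$ if $\sum_{n\ge0}\phi(x^n)\frac{t^n}{n!}=e^{xf(t)}$. A delta operator is a shift-invariant operator $Q$ on $\mathbb C[x]$ for which $Qx$ is a nonzero constant; it is associated with $\phi$ if $Q\phi(x^n)=n\,\phi(x^{n-1})$ for all $n>0$. (Existence and uniqueness of iterates.) Let $l\in\mathbb C$ with $e^l=f'(0)$, and suppose that $f'(0)$ is not a root of unity, or that $f'(0)=1$ and $l=0$. Then $f$ has exactly one system of fractional iterates with $(f^s)'(0)=e^{sl}$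 for all $s\in\mathbb C$. (Fractional exponents.) Let $(f^s)_{s\in\mathbb C}$ be any system of fractional iterates of $f$, and let $\phi$ be the umbral operator generated by $f$. For $s\in\mathbb C$ define $$\phi^s:=e^{s\,\mathbf x\operatorname{itlog}(f)(D)}=\sum_{k\ge0}\frac{s^k}{k!}\bigl(\mathbf x\operatorname{itlog}(f)(D)\bigr)^k,\qquad Q^{[s]}:=f^{-s}(D).$$ Then, for all $s,t\in\mathbb C$: 1. The exponential series applied to any polynomial converges coefficientwise to a polynomial, so $\phi^s$ is a well-defined operator on $\mathbb C[x]$. 2. $f^s$ has $f^s(0)=0$ and $(f^s)'(0)\ne0$, and $\phi^s$ is the umbral operator generated by $f^s$; in particular $\phi^1=\phi$. 3. $(f^{sr})_{r\in\mathbb C}$ is a system of fractional iterates of $f^s$, and with respect to it $\operatorname{itlog}(f^s)=s\operatorname{itlog}(f)$. 4. $\phi^0=1$, $\phi^{s+t}=\phi^s\phi^t$, and the infinitesimal generator $\frac{d}{ds}\phi^s\big|_{s=0}$ (coefficientwise on each polynomial) is $\mathbf x\operatorname{itlog}(f)(D)$. 5. $Q^{[s]}$ is a delta operator, it is associated with $\phi^s$,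 and $Q^{[t]}\phi^s=\phi^sQ^{[t-s]}$. 6. $(Q^{[s]})_{s\in\mathbb C}$ is a one-parameter group under the law $g(D)\diamond h(D):=(g\circ h)(D)$: $Q^{[0]}=D$ and $Q^{[s+t]}=Q^{[s]}\diamond Q^{[t]}$. Its infinitesimal generator $\frac{d}{ds}Q^{[s]}\big|_{s=0}$ is $-\operatorname{itlog}(f)(D)$. -/

import Mathlib

open scoped Polynomial PowerSeries

noncomputable section

namespace UmbralFrac

/-- Operators mapping polynomials to polynomials, with composition as product. -/
abbrev Op : Type := Module.End ℂ ℂ[X]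

/-! ### Formal power series under composition -/

/-- `comp g h` is the composite `g ∘ h`, that is `g(h(t))` (used for `h(0) = 0`). -/
def comp (g h : ℂ⟦X⟧) : ℂ⟦X⟧ := PowerSeries.subst h g

/-- Compositionally invertible series: `f(0) = 0` and `f'(0) ≠ 0`. -/
def IsInvertible (f : ℂ⟦X⟧) : Prop :=
  PowerSeries.constantCoeff f = 0 ∧ PowerSeries.coeff 1 f ≠ 0

/-- `F` is a system `s ↦ f ^ s` of fractional compositional iterates of `f`, depending on `s` in
such a way that the derivative at `s = 0` makes sense. -/
structure IsFracIter (f : ℂ⟦X⟧) (F : ℂ → ℂ⟦X⟧) : Prop where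
  one : F 1 = f
  constantCoeff_eq_zero : ∀ s, PowerSeries.constantCoeff (F s) = 0
  add : ∀ r s, F (r + s) = comp (F r) (F s)
  differentiableAt : ∀ n, DifferentiableAt ℂ (fun s => PowerSeries.coeff n (F s)) 0

/-- The iterative logarithm, the coefficientwise derivative of `f ^ s` at `s = 0`. -/
def itlog (F : ℂ → ℂ⟦X⟧) : ℂ⟦X⟧ :=
  PowerSeries.mk fun n => deriv (fun s => PowerSeries.coeff n (F s)) 0

/-! ### Operators -/

/-- The terms of `g(D) p = ∑ₖ gₖ Dᵏ p` vanish beyond the degree of `p`. -/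
theorem sum_range_eq (g : ℂ⟦X⟧) (p : ℂ[X]) {N : ℕ} (hN : p.natDegree ≤ N) :
    ∑ k ∈ Finset.range (p.natDegree + 1),
        PowerSeries.coeff k g • Polynomial.derivative^[k] p =
      ∑ k ∈ Finset.range (N + 1), PowerSeries.coeff k g • Polynomial.derivative^[k] p := by
  refine Finset.sum_subset (fun k hk => ?_) (fun k _ hk => ?_)
  · simp only [Finset.mem_range] at hk ⊢
    omega
  · rw [Polynomial.iterate_derivative_eq_zero (by simp at hk; omega), smul_zero]

/-- The shift-invariant operator `g(D) = ∑ₖ gₖ Dᵏ`, where `g(t) = ∑ₖ gₖ tᵏ`. -/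
def opD (g : ℂ⟦X⟧) : Op where
  toFun p := ∑ k ∈ Finset.range (p.natDegree + 1),
    PowerSeries.coeff k g • Polynomial.derivative^[k] p
  map_add' p q := by
    rw [sum_range_eq g (p + q) (Polynomial.natDegree_add_le p q),
      sum_range_eq g p (le_max_left p.natDegree q.natDegree),
      sum_range_eq g q (le_max_right p.natDegree q.natDegree), ← Finset.sum_add_distrib]
    simp [iterate_map_add]
  map_smul' c p := by
    rw [sum_range_eq g (c • p) (Polynomial.natDegree_smul_le c p), RingHom.id_apply,
      Finset.smul_sum]
    refine Finset.sum_congr rfl fun k _ => ?_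
    rw [Polynomial.iterate_derivative_smul, smul_comm]

/-- The operator `𝐱` of multiplication by the variable. -/
def opX : Op := LinearMap.mulLeft ℂ (Polynomial.X : ℂ[X])

/-- `E = e ^ A = ∑ₖ Aᵏ / k!`: for each polynomial `p`, the series `∑ₖ Aᵏ p / k!` converges
coefficientwise to `E p`. -/
def IsExp (A E : Op) : Prop :=
  ∀ (p : ℂ[X]) (m : ℕ),
    HasSum (fun k : ℕ => (Nat.factorial k : ℂ)⁻¹ * ((A ^ k) p).coeff m) ((E p).coeff m)

open Classical in
/-- The operator `e ^ A`; the value is `0` if the exponential series of `A` does not converge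
to an operator on polynomials. -/
def opExp (A : Op) : Op := if h : ∃ E, IsExp A E then h.choose else 0

/-- `A` is the infinitesimal generator of the family `U`: the coefficientwise derivative of `U s`
at `s = 0` is `A`. -/
def IsGenerator (A : Op) (U : ℂ → Op) : Prop :=
  ∀ (p : ℂ[X]) (m : ℕ), HasDerivAt (fun s => (U s p).coeff m) ((A p).coeff m) 0

/-! ### Umbral operators and delta operators -/

/-- The generating function `∑ₙ U(xⁿ) tⁿ / n!` of an operator, a power series in `t` whose
coefficients are polynomials in `x`. -/
def genFun (U : Op) : PowerSeries ℂ[X] :=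
  PowerSeries.mk fun n => (Nat.factorial n : ℂ)⁻¹ • U (Polynomial.X ^ n)

/-- The power series `e ^ (x f(t))` in `t` over `ℂ[x]` (used for `f(0) = 0`). -/
def expGen (f : ℂ⟦X⟧) : PowerSeries ℂ[X] :=
  PowerSeries.subst (PowerSeries.C (Polynomial.X : ℂ[X]) * PowerSeries.map Polynomial.C f)
    (PowerSeries.exp ℂ[X])

/-- `U` is the umbral operator generated by the invertible series `f`. -/
def IsUmbral (U : Op) (f : ℂ⟦X⟧) : Prop := IsInvertible f ∧ genFun U = expGen f

/-- Delta operators: shift-invariant operators sending `x` to a nonzero constant. -/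
def IsDelta (Q : Op) : Prop :=
  (∀ (a : ℂ) (p : ℂ[X]), Q (Polynomial.taylor a p) = Polynomial.taylor a (Q p)) ∧
    ∃ c : ℂ, c ≠ 0 ∧ Q Polynomial.X = Polynomial.C c

/-- `Q` is the delta operator associated with `U`: it is a delta operator and, for all `n > 0`,
`Q Uₙ(x) = n Uₙ₋₁(x)`, where `Uₙ(x) = U xⁿ`. -/
def IsAssocDelta (Q U : Op) : Prop :=
  IsDelta Q ∧ ∀ n : ℕ,
    Q (U (Polynomial.X ^ (n + 1))) = ((n + 1 : ℕ) : ℂ) • U (Polynomial.X ^ n)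

/-- The power series `g` with `U = g(D)`, for a shift-invariant operator `U`. -/
def symbol (U : Op) : ℂ⟦X⟧ :=
  PowerSeries.mk fun k => (Nat.factorial k : ℂ)⁻¹ * (U (Polynomial.X ^ k)).coeff 0

theorem symbol_opD (g : ℂ⟦X⟧) : symbol (opD g) = g := by
  ext n
  simp only [symbol, opD, LinearMap.coe_mk, AddHom.coe_mk, PowerSeries.coeff_mk,
    Polynomial.natDegree_X_pow, Polynomial.finsetSum_coeff, Polynomial.coeff_smul, smul_eq_mul]
  rw [Finset.sum_eq_single n]
  · rw [Polynomial.iterate_derivative_X_pow_eq_smul]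
    have : (Nat.factorial n : ℂ) ≠ 0 := by exact_mod_cast n.factorial_ne_zero
    simp [Nat.descFactorial_self]
    field_simp
  · intro k hk hkn
    rw [Polynomial.iterate_derivative_X_pow_eq_smul, Polynomial.coeff_smul,
      Polynomial.coeff_X_pow]
    have : n - k ≠ 0 := by simp at hk; omega
    simp [this.symm]
  · simp

/-- The composition law `g(D) ⋄ h(D) = (g ∘ h)(D)` on shift-invariant operators. -/
def diamond (U V : Op) : Op := opD (comp (symbol U) (symbol V))

/-! ### Fractional exponents -/

/-- The operator `𝐱 itlog(f)(D)`, where `F s = f ^ s`. -/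
def logOp (F : ℂ → ℂ⟦X⟧) : Op := opX * opD (itlog F)

/-- `φ ^ s = e ^ (s 𝐱 itlog(f)(D))`, where `F s = f ^ s`. -/
def fracPow (F : ℂ → ℂ⟦X⟧) (s : ℂ) : Op := opExp (s • logOp F)

/-- `Q^[s] = f ^ (-s) (D)`, where `F s = f ^ s`. -/
def fracDelta (F : ℂ → ℂ⟦X⟧) (s : ℂ) : Op := opD (F (-s))

end UmbralFrac

end

open scoped Polynomial PowerSeries

noncomputable section

namespace UmbralFrac

/-! ### Composition of power series -/

/-! Everything about operators is transported to power series by the pairing `⟨g, p⟩ = (g(D) p)(0)`,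
which separates polynomials. Under it `h(D)` is adjoint to multiplication by `h`, `𝐱` to `d/dt`, and
the umbral operator `umb f` to `g ↦ g ∘ f` (`pair_opD`, `pair_opX`, `pair_umb`). Hence `s ↦ umb (F
s)` is a one-parameter group, and by the chain rule at the identity its generator is the adjoint of
the derivation `itlog · d/dt`, namely `logOp F`. The group law makes each coefficient of `umb (F s)
p` entire in `s`; its Taylor series at `0` is the exponential series, so `φ ^ s = umb (F s)`
(`isExp_umb`). The remaining claims on `φ ^ s` and `Q^[s]` then follow from identities between the
series `F s`.

For uniqueness, `itlog F` determines `F` through this exponential. If `f'(0)` is not a root of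
unity, two logarithms with the same linear coefficient agree, because both solve the linear equation
`v ∘ f = v f'`. In the case `l = 0`, the coefficients of `F s` are polynomials in `s` with values
prescribed on `ℕ`.

For existence, Schröder's equation conjugates `f` to `t ↦ f'(0) t`, whose iterates are evident; if
`f'(0) = 1`, the binomial series of `C_f = 1 + (C_f - 1)` is used, where `C_f` is composition with
`f` and `C_f - 1` raises the order. -/

theorem coeff_pow_eq_zero_of_lt {R : Type*} [CommRing R] {h : R⟦X⟧}
    (hh : PowerSeries.constantCoeff h = 0) {n k : ℕ} (hnk : n < k) :
    PowerSeries.coeff n (h ^ k) = 0 :=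
  PowerSeries.X_pow_dvd_iff.1 (pow_dvd_pow_of_dvd (PowerSeries.X_dvd_iff.2 hh) k) n hnk

theorem coeff_subst_eq_sum {R S : Type*} [CommRing R] [CommRing S] [Algebra R S] {h : S⟦X⟧}
    (hh : PowerSeries.constantCoeff h = 0) (g : R⟦X⟧) {n N : ℕ} (hN : n ≤ N) :
    PowerSeries.coeff n (PowerSeries.subst h g) =
      ∑ k ∈ Finset.range (N + 1), PowerSeries.coeff k g • PowerSeries.coeff n (h ^ k) := by
  rw [PowerSeries.coeff_subst' (PowerSeries.HasSubst.of_constantCoeff_zero' hh)]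
  refine finsum_eq_sum_of_support_subset _ fun k hk => ?_
  simp only [Finset.coe_range, Set.mem_Iio]
  by_contra hlt
  exact hk (by simp only [coeff_pow_eq_zero_of_lt hh (show n < k by omega), smul_zero])

theorem coeff_comp {h : ℂ⟦X⟧} (hh : PowerSeries.constantCoeff h = 0) (g : ℂ⟦X⟧) {n N : ℕ}
    (hN : n ≤ N) : PowerSeries.coeff n (comp g h) =
      ∑ k ∈ Finset.range (N + 1), PowerSeries.coeff k g * PowerSeries.coeff n (h ^ k) :=
  coeff_subst_eq_sum hh g hN

theorem comp_mul {h : ℂ⟦X⟧} (hh : PowerSeries.constantCoeff h = 0) (g₁ g₂ : ℂ⟦X⟧) :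
    comp (g₁ * g₂) h = comp g₁ h * comp g₂ h :=
  PowerSeries.subst_mul (PowerSeries.HasSubst.of_constantCoeff_zero' hh) g₁ g₂

theorem comp_pow {h : ℂ⟦X⟧} (hh : PowerSeries.constantCoeff h = 0) (g : ℂ⟦X⟧) (n : ℕ) :
    comp (g ^ n) h = comp g h ^ n :=
  PowerSeries.subst_pow (PowerSeries.HasSubst.of_constantCoeff_zero' hh) g n

theorem comp_sub {h : ℂ⟦X⟧} (hh : PowerSeries.constantCoeff h = 0) (g₁ g₂ : ℂ⟦X⟧) :
    comp (g₁ - g₂) h = comp g₁ h - comp g₂ h :=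
  PowerSeries.subst_sub (PowerSeries.HasSubst.of_constantCoeff_zero' hh) g₁ g₂

theorem comp_smul {h : ℂ⟦X⟧} (hh : PowerSeries.constantCoeff h = 0) (c : ℂ) (g : ℂ⟦X⟧) :
    comp (c • g) h = c • comp g h :=
  PowerSeries.subst_smul (PowerSeries.HasSubst.of_constantCoeff_zero' hh) c g

theorem comp_X (g : ℂ⟦X⟧) : comp g PowerSeries.X = g :=
  PowerSeries.X_subst g

theorem X_comp {h : ℂ⟦X⟧} (hh : PowerSeries.constantCoeff h = 0) :
    comp PowerSeries.X h = h :=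
  PowerSeries.subst_X (PowerSeries.HasSubst.of_constantCoeff_zero' hh)

theorem comp_assoc {g h : ℂ⟦X⟧} (hg : PowerSeries.constantCoeff g = 0)
    (hh : PowerSeries.constantCoeff h = 0) (k : ℂ⟦X⟧) :
    comp (comp k g) h = comp k (comp g h) :=
  PowerSeries.subst_comp_subst_apply (PowerSeries.HasSubst.of_constantCoeff_zero' hg)
    (PowerSeries.HasSubst.of_constantCoeff_zero' hh) k

theorem constantCoeff_comp {g h : ℂ⟦X⟧} (hh : PowerSeries.constantCoeff h = 0) :
    PowerSeries.constantCoeff (comp g h) = PowerSeries.constantCoeff g := by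
  have := coeff_comp hh g (le_refl 0)
  simpa using this

theorem coeff_one_comp {g h : ℂ⟦X⟧} (hh : PowerSeries.constantCoeff h = 0) :
    PowerSeries.coeff 1 (comp g h) = PowerSeries.coeff 1 g * PowerSeries.coeff 1 h := by
  rw [coeff_comp hh g le_rfl, Finset.sum_range_succ, Finset.sum_range_one]
  simp [PowerSeries.coeff_one]

theorem coeff_pow_self {h : ℂ⟦X⟧} (hh : PowerSeries.constantCoeff h = 0) (n : ℕ) :
    PowerSeries.coeff n (h ^ n) = PowerSeries.coeff 1 h ^ n := by
  obtain ⟨g, rfl⟩ := PowerSeries.X_dvd_iff.2 hh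
  rw [mul_pow, PowerSeries.coeff_X_pow_mul', if_pos le_rfl, Nat.sub_self,
    PowerSeries.coeff_zero_eq_constantCoeff_apply, map_pow,
    ← PowerSeries.coeff_zero_eq_constantCoeff_apply]
  congr 1
  simp

/-- An invertible series has a two-sided compositional inverse. -/
theorem IsInvertible.exists_inverse {f : ℂ⟦X⟧} (hf : IsInvertible f) :
    ∃ g, PowerSeries.constantCoeff g = 0 ∧ comp f g = PowerSeries.X ∧
      comp g f = PowerSeries.X := by
  have hu : IsUnit (PowerSeries.coeff 1 f) := isUnit_iff_ne_zero.2 hf.2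
  exact ⟨f.substInvOfIsUnit hu, PowerSeries.constantCoeff_substInvOfIsUnit _ hu,
    PowerSeries.subst_substInvOfIsUnit_right _ hf.1 hu,
    PowerSeries.subst_substInvOfIsUnit_left _ hf.1 hu⟩

/-! ### Basic properties of fractional iterates -/

section IsFracIter

variable {f : ℂ⟦X⟧} {F : ℂ → ℂ⟦X⟧}

/-- From `f = f ∘ F 0`, cancel `f` on the left. -/
theorem IsFracIter.zero (hf : IsInvertible f) (hF : IsFracIter f F) : F 0 = PowerSeries.X := by
  obtain ⟨g, hg0, -, hg⟩ := hf.exists_inverse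
  have h := hF.add 1 0
  rw [add_zero, hF.one] at h
  rw [← X_comp (hF.constantCoeff_eq_zero 0), ← hg,
    comp_assoc hf.1 (hF.constantCoeff_eq_zero 0), ← h]

theorem IsFracIter.isInvertible (hf : IsInvertible f) (hF : IsFracIter f F) (s : ℂ) :
    IsInvertible (F s) := by
  refine ⟨hF.constantCoeff_eq_zero s, fun h => ?_⟩
  have h1 := congrArg (PowerSeries.coeff 1) (hF.add s (-s))
  rw [add_neg_cancel, hF.zero hf, coeff_one_comp (hF.constantCoeff_eq_zero _), h] at h1
  simp at h1

theorem IsFracIter.rescale (hF : IsFracIter f F) (s : ℂ) :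
    IsFracIter (F s) (fun r => F (s * r)) where
  one := by simp
  constantCoeff_eq_zero r := hF.constantCoeff_eq_zero _
  add r t := by rw [mul_add, hF.add]
  differentiableAt n := by
    have h : DifferentiableAt ℂ (fun s => PowerSeries.coeff n (F s)) (s * 0) := by
      simpa using hF.differentiableAt n
    exact h.comp (𝕜 := ℂ) 0 (differentiableAt_id.const_mul s)

theorem itlog_rescale (F : ℂ → ℂ⟦X⟧) (s : ℂ) :
    itlog (fun r => F (s * r)) = s • itlog F := by
  ext n
  simpa [itlog] using deriv_comp_mul_left s (fun r => PowerSeries.coeff n (F r)) 0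

theorem IsFracIter.hasDerivAt_coeff (hF : IsFracIter f F) (n : ℕ) :
    HasDerivAt (fun s => PowerSeries.coeff n (F s)) (PowerSeries.coeff n (itlog F)) 0 := by
  simpa [itlog] using (hF.differentiableAt n).hasDerivAt

theorem IsFracIter.constantCoeff_itlog (hF : IsFracIter f F) :
    PowerSeries.constantCoeff (itlog F) = 0 := by
  simp [itlog, hF.constantCoeff_eq_zero, ← PowerSeries.coeff_zero_eq_constantCoeff_apply]

/-- Coefficientwise chain rule at the identity. -/
theorem IsFracIter.hasDerivAt_coeff_pow (hf : IsInvertible f) (hF : IsFracIter f F) (k n : ℕ) :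
    HasDerivAt (fun s => PowerSeries.coeff n (F s ^ k))
      (PowerSeries.coeff n (itlog F * PowerSeries.derivative ℂ (PowerSeries.X ^ k))) 0 := by
  induction k generalizing n with
  | zero => simpa using hasDerivAt_const (0 : ℂ) (PowerSeries.coeff n (1 : ℂ⟦X⟧))
  | succ k ih =>
    have h : HasDerivAt (fun s => ∑ ij ∈ Finset.HasAntidiagonal.antidiagonal n,
        PowerSeries.coeff ij.1 (F s ^ k) * PowerSeries.coeff ij.2 (F s)) _ 0 :=
      HasDerivAt.fun_sum fun ij _ => (ih ij.1).mul (hF.hasDerivAt_coeff ij.2)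
    simp only [← PowerSeries.coeff_mul, Finset.sum_add_distrib, hF.zero hf, ← pow_succ] at h
    convert h using 1
    rw [← map_add]
    congr 1
    simp only [pow_succ, Derivation.leibniz, PowerSeries.derivative_X, smul_eq_mul]
    ring

theorem IsFracIter.hasDerivAt_coeff_comp (hf : IsInvertible f) (hF : IsFracIter f F)
    (g : ℂ⟦X⟧) (n : ℕ) :
    HasDerivAt (fun s => PowerSeries.coeff n (comp g (F s)))
      (PowerSeries.coeff n (itlog F * PowerSeries.derivative ℂ g)) 0 := by
  have h : HasDerivAt (fun s => ∑ k ∈ Finset.range (n + 1),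
      PowerSeries.coeff k g * PowerSeries.coeff n (F s ^ k)) _ 0 :=
    HasDerivAt.fun_sum fun k _ => (hF.hasDerivAt_coeff_pow hf k n).const_mul _
  simp only [← coeff_comp (hF.constantCoeff_eq_zero _) g le_rfl] at h
  convert h using 1
  -- Writing `itlog F = t v` and grouping `t` with `g'` gives a factor whose `j`-th coefficient is
  -- `j` times that of `g`. So the `n`-th coefficient sees `g` only up to degree `n`, and the
  -- truncated sum loses nothing.
  obtain ⟨v, hv⟩ := PowerSeries.X_dvd_iff.2 hF.constantCoeff_itlog
  have key : ∀ g' : ℂ⟦X⟧, PowerSeries.coeff n (itlog F * PowerSeries.derivative ℂ g') =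
      ∑ ij ∈ Finset.HasAntidiagonal.antidiagonal n, PowerSeries.coeff ij.1 v *
        (ij.2 * PowerSeries.coeff ij.2 g') := by
    intro g'
    rw [hv, mul_comm PowerSeries.X, mul_assoc, PowerSeries.coeff_mul]
    refine Finset.sum_congr rfl fun ij _ => ?_
    congr 1
    rcases ij.2 with _ | m
    · simp
    · rw [PowerSeries.coeff_succ_X_mul, PowerSeries.coeff_derivative]
      push_cast
      ring
  simp only [key, Finset.mul_sum]
  rw [Finset.sum_comm]
  refine Finset.sum_congr rfl fun ij hij => ?_
  have := Finset.HasAntidiagonal.mem_antidiagonal.1 hij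
  rw [Finset.sum_eq_single ij.2]
  · simp; ring
  · intro b _ hb
    simp [PowerSeries.coeff_X_pow, hb.symm]
  · intro hb
    simp at hb
    omega

end IsFracIter

/-! ### The pairing of power series and polynomials -/

/-- The pairing `⟨g, p⟩ = ∑ₙ gₙ n! pₙ`, that is `(g(D) p)(0)`. -/
def pair (g : ℂ⟦X⟧) : ℂ[X] →ₗ[ℂ] ℂ :=
  Polynomial.lsum fun n => (PowerSeries.coeff n g * (Nat.factorial n : ℂ)) • LinearMap.id

theorem pair_apply (g : ℂ⟦X⟧) (p : ℂ[X]) :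
    pair g p = ∑ n ∈ p.support, PowerSeries.coeff n g * (Nat.factorial n : ℂ) * p.coeff n := by
  simp [pair, Polynomial.lsum_apply, Polynomial.sum_def]

theorem pair_X_pow (g : ℂ⟦X⟧) (n : ℕ) :
    pair g (Polynomial.X ^ n) = PowerSeries.coeff n g * (Nat.factorial n : ℂ) := by
  rw [pair, Polynomial.lsum_apply, ← Polynomial.monomial_one_right_eq_X_pow,
    Polynomial.sum_monomial_index] <;> simp

theorem pair_pow_X (m : ℕ) (p : ℂ[X]) :
    pair (PowerSeries.X ^ m) p = (Nat.factorial m : ℂ) * p.coeff m := by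
  rw [pair_apply, Finset.sum_eq_single m]
  · simp
  · intro b _ hb
    simp [PowerSeries.coeff_X_pow, hb]
  · intro h
    simp [Polynomial.notMem_support_iff.1 h]

theorem coeff_eq_pair (m : ℕ) (p : ℂ[X]) :
    p.coeff m = (Nat.factorial m : ℂ)⁻¹ * pair (PowerSeries.X ^ m) p := by
  rw [pair_pow_X, inv_mul_cancel_left₀ (by exact_mod_cast m.factorial_ne_zero)]

theorem pair_ext {p q : ℂ[X]} (h : ∀ g, pair g p = pair g q) : p = q := by
  ext m
  rw [coeff_eq_pair, coeff_eq_pair, h]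

theorem linearMap_ext_X_pow {M : Type*} [AddCommMonoid M] [Module ℂ M] {L₁ L₂ : ℂ[X] →ₗ[ℂ] M}
    (h : ∀ n : ℕ, L₁ (Polynomial.X ^ n) = L₂ (Polynomial.X ^ n)) : L₁ = L₂ := by
  refine Polynomial.lhom_ext' fun n => LinearMap.ext_ring ?_
  simpa [Polynomial.monomial_one_right_eq_X_pow] using h n

theorem opD_apply (g : ℂ⟦X⟧) {p : ℂ[X]} {N : ℕ} (hN : p.natDegree ≤ N) :
    opD g p = ∑ k ∈ Finset.range (N + 1),
      PowerSeries.coeff k g • Polynomial.derivative^[k] p :=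
  sum_range_eq g p hN

/-- `h(D)` is adjoint to multiplication by `h`. -/
theorem pair_opD (g h : ℂ⟦X⟧) (p : ℂ[X]) : pair g (opD h p) = pair (g * h) p := by
  suffices (pair g).comp (opD h) = pair (g * h) from LinearMap.congr_fun this p
  refine linearMap_ext_X_pow fun n => ?_
  rw [LinearMap.comp_apply, opD_apply h (Polynomial.natDegree_X_pow n).le, map_sum, pair_X_pow,
    mul_comm g h, PowerSeries.coeff_mul, Finset.Nat.sum_antidiagonal_eq_sum_range_succ_mk,
    Finset.sum_mul]
  refine Finset.sum_congr rfl fun k hk => ?_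
  have hk : k ≤ n := Nat.lt_succ_iff.1 (Finset.mem_range.1 hk)
  rw [map_smul, Polynomial.iterate_derivative_X_pow_eq_smul, map_smul, pair_X_pow,
    ← Nat.factorial_mul_descFactorial hk]
  simp only [smul_eq_mul]
  push_cast
  ring

/-- Multiplication by the variable is adjoint to differentiation. -/
theorem pair_opX (g : ℂ⟦X⟧) (p : ℂ[X]) :
    pair g (opX p) = pair (PowerSeries.derivative ℂ g) p := by
  suffices (pair g).comp opX = pair (PowerSeries.derivative ℂ g) from LinearMap.congr_fun this p
  refine linearMap_ext_X_pow fun n => ?_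
  rw [LinearMap.comp_apply, opX, LinearMap.mulLeft_apply, ← pow_succ', pair_X_pow, pair_X_pow,
    PowerSeries.coeff_derivative, Nat.factorial_succ]
  push_cast
  ring

/-- Taking adjoints reverses the product: differentiate first, then multiply by `itlog F`. -/
theorem pair_logOp (F : ℂ → ℂ⟦X⟧) (g : ℂ⟦X⟧) (p : ℂ[X]) :
    pair g (logOp F p) = pair (itlog F * PowerSeries.derivative ℂ g) p := by
  rw [logOp, Module.End.mul_apply, pair_opX, pair_opD, mul_comm]

theorem hasDerivAt_pair {G : ℂ → ℂ⟦X⟧} {G' : ℂ⟦X⟧} {s : ℂ}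
    (h : ∀ n, HasDerivAt (fun t => PowerSeries.coeff n (G t)) (PowerSeries.coeff n G') s)
    (p : ℂ[X]) : HasDerivAt (fun t => pair (G t) p) (pair G' p) s := by
  simp only [pair_apply]
  exact HasDerivAt.fun_sum fun n _ => ((h n).mul_const _).mul_const _

/-! ### Umbral operators -/

/-- The umbral operator generated by `f`, the adjoint of composition with `f`. -/
def umb (f : ℂ⟦X⟧) : Op :=
  Polynomial.lsum fun n => LinearMap.toSpanSingleton ℂ ℂ[X]
    (∑ k ∈ Finset.range (n + 1),
      ((Nat.factorial n : ℂ) * (Nat.factorial k : ℂ)⁻¹ * PowerSeries.coeff n (f ^ k)) •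
        Polynomial.X ^ k)

theorem umb_X_pow (f : ℂ⟦X⟧) (n : ℕ) : umb f (Polynomial.X ^ n) =
    ∑ k ∈ Finset.range (n + 1),
      ((Nat.factorial n : ℂ) * (Nat.factorial k : ℂ)⁻¹ * PowerSeries.coeff n (f ^ k)) •
        Polynomial.X ^ k := by
  rw [umb, Polynomial.lsum_apply, ← Polynomial.monomial_one_right_eq_X_pow,
    Polynomial.sum_monomial_index] <;> simp

theorem pair_umb {f : ℂ⟦X⟧} (hf : PowerSeries.constantCoeff f = 0) (g : ℂ⟦X⟧) (p : ℂ[X]) :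
    pair g (umb f p) = pair (comp g f) p := by
  suffices (pair g).comp (umb f) = pair (comp g f) from LinearMap.congr_fun this p
  refine linearMap_ext_X_pow fun n => ?_
  rw [LinearMap.comp_apply, umb_X_pow, map_sum, pair_X_pow, coeff_comp hf g le_rfl,
    Finset.sum_mul]
  refine Finset.sum_congr rfl fun k _ => ?_
  have : (Nat.factorial k : ℂ) ≠ 0 := by exact_mod_cast k.factorial_ne_zero
  rw [map_smul, pair_X_pow, smul_eq_mul]
  field_simp

theorem umb_comp {f g : ℂ⟦X⟧} (hf : PowerSeries.constantCoeff f = 0)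
    (hg : PowerSeries.constantCoeff g = 0) : umb (comp f g) = umb f * umb g := by
  refine LinearMap.ext fun p => pair_ext fun k => ?_
  rw [Module.End.mul_apply, pair_umb hf, pair_umb hg, comp_assoc hf hg,
    pair_umb (by rw [constantCoeff_comp hg, hf])]

theorem umb_X : umb PowerSeries.X = 1 :=
  LinearMap.ext fun p => pair_ext fun k => by
    rw [pair_umb PowerSeries.constantCoeff_X, comp_X, Module.End.one_apply]

theorem genFun_umb {f : ℂ⟦X⟧} (hf : PowerSeries.constantCoeff f = 0) :
    genFun (umb f) = expGen f := by
  have h0 : PowerSeries.constantCoeff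
      (PowerSeries.C (Polynomial.X : ℂ[X]) * PowerSeries.map Polynomial.C f) = 0 := by
    rw [map_mul, ← PowerSeries.coeff_zero_eq_constantCoeff_apply (PowerSeries.map Polynomial.C f),
      PowerSeries.coeff_map, PowerSeries.coeff_zero_eq_constantCoeff_apply, hf, map_zero, mul_zero]
  ext1 n
  rw [genFun, PowerSeries.coeff_mk, umb_X_pow, expGen,
    coeff_subst_eq_sum h0 _ le_rfl, Finset.smul_sum]
  refine Finset.sum_congr rfl fun k _ => ?_
  have : (Nat.factorial n : ℂ) ≠ 0 := by exact_mod_cast n.factorial_ne_zero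
  rw [mul_pow, ← map_pow, ← map_pow, PowerSeries.coeff_C_mul, PowerSeries.coeff_map,
    PowerSeries.coeff_exp, smul_smul, Polynomial.smul_eq_C_mul, smul_eq_mul,
    IsScalarTower.algebraMap_apply ℚ ℂ ℂ[X], Polynomial.algebraMap_eq]
  have h : (Nat.factorial n : ℂ)⁻¹ *
      ((Nat.factorial n : ℂ) * (Nat.factorial k : ℂ)⁻¹ * PowerSeries.coeff n (f ^ k)) =
      algebraMap ℚ ℂ (1 / (Nat.factorial k : ℚ)) * PowerSeries.coeff n (f ^ k) := by
    rw [mul_assoc, inv_mul_cancel_left₀ this]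
    simp
  rw [h, Polynomial.C_mul]
  ring

theorem isUmbral_umb {f : ℂ⟦X⟧} (hf : IsInvertible f) : IsUmbral (umb f) f :=
  ⟨hf, genFun_umb hf.1⟩

theorem IsUmbral.eq_umb {f : ℂ⟦X⟧} {U : Op} (hU : IsUmbral U f) : U = umb f := by
  refine linearMap_ext_X_pow fun n => ?_
  have h := congrArg (PowerSeries.coeff n) (hU.2.trans (genFun_umb hU.1.1).symm)
  have hn : (Nat.factorial n : ℂ)⁻¹ ≠ 0 :=
    inv_ne_zero (by exact_mod_cast n.factorial_ne_zero)
  simp only [genFun, PowerSeries.coeff_mk] at h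
  exact smul_right_injective _ hn h

/-! ### Shift-invariant operators -/

theorem opD_X : opD PowerSeries.X = Polynomial.derivative := by
  refine linearMap_ext_X_pow fun n => pair_ext fun g => ?_
  rw [pair_opD, Polynomial.derivative_X_pow, ← Polynomial.smul_eq_C_mul, map_smul, pair_X_pow,
    pair_X_pow]
  rcases n with _ | n
  · simp
  · rw [PowerSeries.coeff_succ_mul_X, Nat.factorial_succ, Nat.add_sub_cancel]
    push_cast
    simp only [smul_eq_mul]
    ring

theorem opD_apply_X {g : ℂ⟦X⟧} (hg : PowerSeries.constantCoeff g = 0) :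
    opD g Polynomial.X = Polynomial.C (PowerSeries.coeff 1 g) := by
  rw [opD_apply g Polynomial.natDegree_X.le]
  simp [Finset.sum_range_succ, hg, Polynomial.smul_eq_C_mul]

theorem iterate_derivative_taylor (a : ℂ) (p : ℂ[X]) (k : ℕ) :
    Polynomial.derivative^[k] (Polynomial.taylor a p) =
      Polynomial.taylor a (Polynomial.derivative^[k] p) := by
  induction k generalizing p with
  | zero => rfl
  | succ k ih =>
    rw [Function.iterate_succ_apply, Function.iterate_succ_apply, ← ih]
    congr 1
    simp [Polynomial.taylor_apply, Polynomial.derivative_comp]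

theorem isDelta_opD {g : ℂ⟦X⟧} (hg : IsInvertible g) : IsDelta (opD g) := by
  refine ⟨fun a p => ?_, _, hg.2, opD_apply_X hg.1⟩
  rw [opD_apply g (Polynomial.natDegree_taylor p a).le, opD_apply g le_rfl, map_sum]
  simp only [iterate_derivative_taylor, map_smul]

theorem diamond_opD (g h : ℂ⟦X⟧) : diamond (opD g) (opD h) = opD (comp g h) := by
  rw [diamond, symbol_opD, symbol_opD]

/-! ### Exponentials and fractional exponents -/

theorem IsExp.unique {A E₁ E₂ : Op} (h₁ : IsExp A E₁) (h₂ : IsExp A E₂) : E₁ = E₂ :=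
  LinearMap.ext fun p => Polynomial.ext fun m => (h₁ p m).unique (h₂ p m)

theorem IsExp.opExp_eq {A E : Op} (h : IsExp A E) : opExp A = E := by
  have hex : ∃ E, IsExp A E := ⟨E, h⟩
  rw [opExp, dif_pos hex]
  exact hex.choose_spec.unique h

section IsFracIter

variable {f : ℂ⟦X⟧} {F : ℂ → ℂ⟦X⟧}

theorem IsFracIter.umb_add (hF : IsFracIter f F) (s t : ℂ) :
    umb (F (s + t)) = umb (F s) * umb (F t) := by
  rw [hF.add, umb_comp (hF.constantCoeff_eq_zero s) (hF.constantCoeff_eq_zero t)]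

/-- Differentiability of the iterates is assumed only at `0`. Replacing `g` by `g ∘ F s` turns the
derivative at `0` into the derivative at `s`, by the group law. -/
theorem IsFracIter.hasDerivAt_pair_umb (hf : IsInvertible f) (hF : IsFracIter f F) (g : ℂ⟦X⟧)
    (p : ℂ[X]) (s : ℂ) :
    HasDerivAt (fun t => pair g (umb (F t) p)) (pair g (umb (F s) (logOp F p))) s := by
  have h0 : ∀ g, HasDerivAt (fun t => pair g (umb (F t) p)) (pair g (logOp F p)) 0 := by
    intro g
    simp only [pair_umb (hF.constantCoeff_eq_zero _), pair_logOp]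
    exact hasDerivAt_pair (hF.hasDerivAt_coeff_comp hf g) p
  have h1 := h0 (comp g (F s))
  simp only [← pair_umb (hF.constantCoeff_eq_zero s), ← Module.End.mul_apply, ← hF.umb_add] at h1
  rw [← sub_self s] at h1
  simpa using h1.comp_sub_const s s

theorem IsFracIter.hasDerivAt_coeff_umb (hf : IsInvertible f) (hF : IsFracIter f F)
    (p : ℂ[X]) (m : ℕ) (s : ℂ) :
    HasDerivAt (fun t => (umb (F t) p).coeff m) ((umb (F s) (logOp F p)).coeff m) s := by
  simp only [coeff_eq_pair m]
  exact (hF.hasDerivAt_pair_umb hf _ p s).const_mul _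

/-- Each coefficient of `umb (F t) p` is complex differentiable everywhere, hence entire, and
differentiating `k` times replaces `p` by `logOp F ^ k p`. Its Taylor series at `0` therefore
converges at every `s`. -/
theorem IsFracIter.isExp_umb (hf : IsInvertible f) (hF : IsFracIter f F) (s : ℂ) :
    IsExp (s • logOp F) (umb (F s)) := by
  intro p m
  have hit : ∀ k : ℕ, iteratedDeriv k (fun t => (umb (F t) p).coeff m) =
      fun t => (umb (F t) ((logOp F ^ k) p)).coeff m := by
    intro k
    induction k with
    | zero => simp
    | succ k ih =>
      rw [iteratedDeriv_succ, ih]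
      funext t
      rw [(hF.hasDerivAt_coeff_umb hf _ m t).deriv, pow_succ', Module.End.mul_apply]
  have h := Complex.hasSum_taylorSeries_of_entire
    (fun t => (hF.hasDerivAt_coeff_umb hf p m t).differentiableAt) 0 s
  simp only [hit, hF.zero hf, umb_X, sub_zero, Module.End.one_apply] at h
  simpa [smul_pow] using h

theorem IsFracIter.fracPow_eq (hf : IsInvertible f) (hF : IsFracIter f F) (s : ℂ) :
    fracPow F s = umb (F s) :=
  (hF.isExp_umb hf s).opExp_eq

/-- On the dual side this is multiplicativity of composition: `(g · F (-t)) ∘ F s = (g ∘ F s) · F (s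
- t)`. -/
theorem IsFracIter.fracDelta_mul_umb (hF : IsFracIter f F) (s t : ℂ) :
    fracDelta F t * umb (F s) = umb (F s) * fracDelta F (t - s) := by
  refine LinearMap.ext fun p => pair_ext fun g => ?_
  simp only [fracDelta, Module.End.mul_apply, pair_opD, pair_umb (hF.constantCoeff_eq_zero _)]
  rw [comp_mul (hF.constantCoeff_eq_zero _), ← hF.add, neg_sub, neg_add_eq_sub]

theorem IsFracIter.isAssocDelta (hf : IsInvertible f) (hF : IsFracIter f F) (s : ℂ) :
    IsAssocDelta (fracDelta F s) (umb (F s)) := by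
  refine ⟨isDelta_opD (hF.isInvertible hf (-s)), fun n => ?_⟩
  rw [← Module.End.mul_apply, hF.fracDelta_mul_umb, sub_self, fracDelta, neg_zero, hF.zero hf,
    opD_X, Module.End.mul_apply, Polynomial.derivative_X_pow, ← Polynomial.smul_eq_C_mul,
    map_smul, Nat.add_sub_cancel]

theorem IsFracIter.isGenerator_fracDelta (hF : IsFracIter f F) :
    IsGenerator (-opD (itlog F)) (fracDelta F) := by
  intro p m
  have hd : ∀ k, HasDerivAt (fun s => PowerSeries.coeff k (F (-s)))
      (-PowerSeries.coeff k (itlog F)) 0 := by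
    intro k
    have := hF.hasDerivAt_coeff k
    rw [← sub_zero (0 : ℂ)] at this
    simpa using this.comp_const_sub 0 0
  simp only [fracDelta, LinearMap.neg_apply, opD_apply _ (le_refl p.natDegree),
    Polynomial.coeff_neg, Polynomial.finsetSum_coeff, Polynomial.coeff_smul, smul_eq_mul,
    ← Finset.sum_neg_distrib, ← neg_mul]
  exact HasDerivAt.fun_sum fun k _ => (hd k).mul_const _

end IsFracIter

/-! ### Uniqueness of fractional iterates -/

theorem umb_injective {f g : ℂ⟦X⟧} (hf : PowerSeries.constantCoeff f = 0)
    (hg : PowerSeries.constantCoeff g = 0) (h : umb f = umb g) : f = g := by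
  ext n
  have h1 : pair (comp PowerSeries.X f) (Polynomial.X ^ n) =
      pair (comp PowerSeries.X g) (Polynomial.X ^ n) := by
    rw [← pair_umb hf, ← pair_umb hg, h]
  rw [X_comp hf, X_comp hg, pair_X_pow, pair_X_pow] at h1
  exact mul_right_cancel₀ (by exact_mod_cast n.factorial_ne_zero) h1

theorem eq_of_eval_natCast_eq {P Q : ℂ[X]} (h : ∀ k : ℕ, P.eval (k : ℂ) = Q.eval (k : ℂ)) :
    P = Q := by
  refine Polynomial.eq_of_infinite_eval_eq P Q ?_
  refine (Set.infinite_range_of_injective (Nat.cast_injective (R := ℂ))).mono ?_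
  rintro _ ⟨k, rfl⟩
  exact h k

theorem coeff_itlog_one {F : ℂ → ℂ⟦X⟧} {l : ℂ}
    (h : ∀ s, PowerSeries.coeff 1 (F s) = Complex.exp (s * l)) :
    PowerSeries.coeff 1 (itlog F) = l := by
  have hd : HasDerivAt (fun s : ℂ => Complex.exp (s * l)) l 0 := by
    simpa using ((hasDerivAt_id (0 : ℂ)).mul_const l).cexp
  simp only [itlog, PowerSeries.coeff_mk, h]
  exact hd.deriv

/-- The linear equation `w ∘ f = w f'` has no nonzero solution of order at least two unless
`f'(0)` is a root of unity. -/
theorem eq_zero_of_comp_eq_mul_derivative {f w : ℂ⟦X⟧} (hf : IsInvertible f)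
    (ha : ∀ n : ℕ, 0 < n → PowerSeries.coeff 1 f ^ n ≠ 1)
    (h0 : PowerSeries.coeff 0 w = 0) (h1 : PowerSeries.coeff 1 w = 0)
    (hw : comp w f = w * PowerSeries.derivative ℂ f) : w = 0 := by
  ext n
  rw [map_zero]
  induction n using Nat.strong_induction_on with
  | _ n ih =>
    rcases n with _ | _ | n
    · exact h0
    · exact h1
    -- With all lower coefficients of `w` zero, only `wₙ₊₂ aⁿ⁺² = wₙ₊₂ a` remains, where `a =
    -- f'(0)`; a nonzero `wₙ₊₂` would force `aⁿ⁺¹ = 1`.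
    · have h := congrArg (PowerSeries.coeff (n + 2)) hw
      rw [coeff_comp hf.1 w le_rfl, Finset.sum_range_succ _ (n + 2), PowerSeries.coeff_mul,
        Finset.Nat.sum_antidiagonal_eq_sum_range_succ_mk, Nat.succ_eq_add_one,
        Finset.sum_range_succ _ (n + 2),
        Finset.sum_eq_zero fun k hk => by rw [ih k (Finset.mem_range.1 hk), zero_mul],
        Finset.sum_eq_zero fun k hk => by rw [ih k (Finset.mem_range.1 hk), zero_mul],
        coeff_pow_self hf.1, PowerSeries.coeff_derivative] at h
      simp only [zero_add, Nat.sub_self, CharP.cast_eq_zero, mul_one] at h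
      by_contra hne
      have h2 := mul_left_cancel₀ hne h
      rw [pow_succ] at h2
      exact ha (n + 1) n.succ_pos (mul_right_cancel₀ hf.2 (h2.trans (one_mul _).symm))

section IsFracIter

variable {f : ℂ⟦X⟧} {F G : ℂ → ℂ⟦X⟧}

theorem IsFracIter.eq_of_itlog_eq (hf : IsInvertible f) (hF : IsFracIter f F)
    (hG : IsFracIter f G) (h : itlog F = itlog G) : F = G := by
  funext s
  refine umb_injective (hF.constantCoeff_eq_zero s) (hG.constantCoeff_eq_zero s) ?_
  rw [← hF.fracPow_eq hf, ← hG.fracPow_eq hf, fracPow, fracPow, logOp, logOp, h]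

/-- Differentiate `F s ∘ f = f ∘ F s` at `s = 0`: the left side is linear in `F s`, the right side
obeys the chain rule. -/
theorem IsFracIter.itlog_comp (hf : IsInvertible f) (hF : IsFracIter f F) :
    comp (itlog F) f = itlog F * PowerSeries.derivative ℂ f := by
  ext n
  refine HasDerivAt.unique (f := fun s => PowerSeries.coeff n (comp (F s) f)) (x := 0) ?_ ?_
  · simp only [coeff_comp hf.1 _ (le_refl n)]
    exact HasDerivAt.fun_sum fun k _ => (hF.hasDerivAt_coeff k).mul_const _
  · have h : ∀ s, comp (F s) f = comp f (F s) := by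
      intro s
      conv_lhs => rw [← hF.one]
      conv_rhs => rw [← hF.one]
      rw [← hF.add, ← hF.add, add_comm]
    simp only [h]
    exact hF.hasDerivAt_coeff_comp hf f n

theorem IsFracIter.eq_of_not_root_of_unity (hf : IsInvertible f)
    (ha : ∀ n : ℕ, 0 < n → PowerSeries.coeff 1 f ^ n ≠ 1) {l : ℂ}
    (hF : IsFracIter f F) (hFl : ∀ s, PowerSeries.coeff 1 (F s) = Complex.exp (s * l))
    (hG : IsFracIter f G) (hGl : ∀ s, PowerSeries.coeff 1 (G s) = Complex.exp (s * l)) :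
    F = G := by
  refine hF.eq_of_itlog_eq hf hG (sub_eq_zero.1 (eq_zero_of_comp_eq_mul_derivative hf ha ?_ ?_ ?_))
  · rw [map_sub, PowerSeries.coeff_zero_eq_constantCoeff_apply,
      PowerSeries.coeff_zero_eq_constantCoeff_apply, hF.constantCoeff_itlog,
      hG.constantCoeff_itlog, sub_zero]
  · rw [map_sub, coeff_itlog_one hFl, coeff_itlog_one hGl, sub_self]
  · rw [comp_sub hf.1, hF.itlog_comp hf, hG.itlog_comp hf, sub_mul]

theorem pair_logOp_pow (F : ℂ → ℂ⟦X⟧) (k : ℕ) (g : ℂ⟦X⟧) (p : ℂ[X]) :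
    pair g ((logOp F ^ k) p) =
      pair ((fun g => itlog F * PowerSeries.derivative ℂ g)^[k] g) p := by
  induction k generalizing g with
  | zero => rfl
  | succ k ih =>
    rw [pow_succ', Module.End.mul_apply, pair_logOp, ih, Function.iterate_succ_apply]

/-- A derivation `v d/dt` with `t² ∣ v` raises the order by at least one. This makes the exponential
series finite in each coefficient. -/
theorem X_pow_dvd_iterate_derivation {v : ℂ⟦X⟧} (hv : PowerSeries.X ^ 2 ∣ v) (k : ℕ) :
    PowerSeries.X ^ (k + 1) ∣
      (fun g => v * PowerSeries.derivative ℂ g)^[k] (PowerSeries.X : ℂ⟦X⟧) := by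
  induction k with
  | zero => simp
  | succ k ih =>
    rw [Function.iterate_succ_apply']
    obtain ⟨g, hg⟩ := ih
    obtain ⟨u, rfl⟩ := hv
    refine ⟨u * (((k + 1 : ℕ) : ℂ⟦X⟧) * g + PowerSeries.X * PowerSeries.derivative ℂ g), ?_⟩
    rw [hg]
    simp only [Derivation.leibniz, Derivation.leibniz_pow, PowerSeries.derivative_X, smul_eq_mul,
      nsmul_eq_mul, Nat.add_sub_cancel]
    ring

/-- The coefficients of the iterates of a series tangent to the identity are polynomials in the
exponent. -/
theorem IsFracIter.exists_polynomial (hf : IsInvertible f) (hF : IsFracIter f F)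
    (h1 : PowerSeries.coeff 1 (itlog F) = 0) (n : ℕ) :
    ∃ P : ℂ[X], ∀ s, PowerSeries.coeff n (F s) = P.eval s := by
  have hv : PowerSeries.X ^ 2 ∣ itlog F := by
    rw [PowerSeries.X_pow_dvd_iff]
    intro m hm
    interval_cases m
    · rw [PowerSeries.coeff_zero_eq_constantCoeff_apply, hF.constantCoeff_itlog]
    · exact h1
  set T : ℂ⟦X⟧ → ℂ⟦X⟧ := fun g => itlog F * PowerSeries.derivative ℂ g
  refine ⟨∑ k ∈ Finset.range n, Polynomial.C ((Nat.factorial k : ℂ)⁻¹ *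
    PowerSeries.coeff n (T^[k] PowerSeries.X)) * Polynomial.X ^ k, fun s => ?_⟩
  have hn : (Nat.factorial n : ℂ) ≠ 0 := by exact_mod_cast n.factorial_ne_zero
  have hterm : ∀ k : ℕ, ((Nat.factorial k : ℂ)⁻¹ *
      (((s • logOp F) ^ k) (Polynomial.X ^ n)).coeff 1) = (Nat.factorial k : ℂ)⁻¹ *
        PowerSeries.coeff n (T^[k] PowerSeries.X) * s ^ k * (Nat.factorial n : ℂ) := by
    intro k
    rw [coeff_eq_pair, smul_pow, LinearMap.smul_apply, map_smul, pow_one, pair_logOp_pow,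
      pair_X_pow, Nat.factorial_one, Nat.cast_one, inv_one, one_mul, smul_eq_mul]
    ring
  -- The coefficient of `x` in `umb (F s) xⁿ` is `n!` times the `n`-th coefficient of `F s`.
  have hsum := hF.isExp_umb hf s (Polynomial.X ^ n) 1
  simp only [hterm] at hsum
  have hfin : HasSum (fun k : ℕ => (Nat.factorial k : ℂ)⁻¹ *
      PowerSeries.coeff n (T^[k] PowerSeries.X) * s ^ k * (Nat.factorial n : ℂ)) _ :=
    hasSum_sum_of_ne_finset_zero (s := Finset.range n) fun k hk => by
      rw [PowerSeries.X_pow_dvd_iff.1 (X_pow_dvd_iterate_derivation hv k) n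
        (by simp at hk; omega)]
      simp
  have h := hsum.unique hfin
  rw [coeff_eq_pair, pow_one, pair_umb (hF.constantCoeff_eq_zero s),
    X_comp (hF.constantCoeff_eq_zero s), pair_X_pow, ← Finset.sum_mul, Nat.factorial_one,
    Nat.cast_one, inv_one, one_mul] at h
  rw [mul_right_cancel₀ hn h]
  simp [Polynomial.eval_finsetSum]

theorem IsFracIter.eq_of_tangent_to_id (hf : IsInvertible f)
    (hF : IsFracIter f F) (hF1 : PowerSeries.coeff 1 (itlog F) = 0)
    (hG : IsFracIter f G) (hG1 : PowerSeries.coeff 1 (itlog G) = 0) : F = G := by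
  have hnat : ∀ k : ℕ, F k = G k := by
    intro k
    induction k with
    | zero => rw [Nat.cast_zero, hF.zero hf, hG.zero hf]
    | succ k ih => rw [Nat.cast_succ, hF.add, hG.add, ih, hF.one, hG.one]
  funext s
  ext n
  obtain ⟨P, hP⟩ := hF.exists_polynomial hf hF1 n
  obtain ⟨Q, hQ⟩ := hG.exists_polynomial hf hG1 n
  rw [hP, hQ, eq_of_eval_natCast_eq (P := P) (Q := Q) fun k => by rw [← hP, ← hQ, hnat]]

end IsFracIter

/-! ### Existence of fractional iterates -/

theorem exists_strong_recursion {α : Type*} (Φ : (n : ℕ) → (Fin n → α) → α) :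
    ∃ u : ℕ → α, ∀ n, u n = Φ n fun k => u k := by
  refine ⟨WellFounded.fix Nat.lt_wfRel.wf fun n u => Φ n fun k => u k k.2, fun n => ?_⟩
  rw [WellFounded.fix_eq]

/-- Schröder's equation: if `a = f'(0)` is not a root of unity, then `σ ∘ f = a σ` has a solution
tangent to the identity. -/
theorem exists_schroeder {f : ℂ⟦X⟧} (hf : IsInvertible f)
    (ha : ∀ n : ℕ, 0 < n → PowerSeries.coeff 1 f ^ n ≠ 1) :
    ∃ σ : ℂ⟦X⟧, PowerSeries.constantCoeff σ = 0 ∧ PowerSeries.coeff 1 σ = 1 ∧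
      comp σ f = PowerSeries.coeff 1 f • σ := by
  set a := PowerSeries.coeff 1 f with ha_def
  -- For `n ≥ 2` this is the `n`-th coefficient of `σ ∘ f = a σ` solved for `uₙ`, whose own
  -- contribution to the left side is `uₙ aⁿ`. At `n = 1` the equation is vacuous, so the value `1`
  -- is a normalisation.
  obtain ⟨u, hu⟩ := exists_strong_recursion fun n (u : Fin n → ℂ) =>
    if n = 0 then 0 else if n = 1 then 1 else
      (∑ k : Fin n, u k * PowerSeries.coeff n (f ^ (k : ℕ))) / (a - a ^ n)
  have hu0 : u 0 = 0 := by rw [hu]; simp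
  have hu1 : u 1 = 1 := by rw [hu]; simp
  refine ⟨PowerSeries.mk u, by simp [← PowerSeries.coeff_zero_eq_constantCoeff_apply, hu0],
    by simp [hu1], ?_⟩
  ext n
  rw [coeff_comp hf.1 _ le_rfl, map_smul, smul_eq_mul]
  simp only [PowerSeries.coeff_mk]
  rcases n with _ | _ | n
  · simp [hu0]
  · simp [Finset.sum_range_succ, hu0, hu1, ha_def]
  · have hne : a - a ^ (n + 2) ≠ 0 := by
      intro h
      refine ha (n + 1) n.succ_pos (mul_right_cancel₀ hf.2 ?_)
      rw [one_mul, ← pow_succ]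
      exact (sub_eq_zero.1 h).symm
    have h := hu (n + 2)
    rw [if_neg (by omega), if_neg (by omega), eq_div_iff hne,
      Fin.sum_univ_eq_sum_range (fun k => u k * PowerSeries.coeff (n + 2) (f ^ k)) (n + 2)] at h
    rw [Finset.sum_range_succ, ← h, coeff_pow_self hf.1]
    ring

theorem exists_isFracIter_of_not_root_of_unity {f : ℂ⟦X⟧} (hf : IsInvertible f)
    (ha : ∀ n : ℕ, 0 < n → PowerSeries.coeff 1 f ^ n ≠ 1) {l : ℂ}
    (hl : Complex.exp l = PowerSeries.coeff 1 f) :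
    ∃ F : ℂ → ℂ⟦X⟧, IsFracIter f F ∧
      ∀ s, PowerSeries.coeff 1 (F s) = Complex.exp (s * l) := by
  obtain ⟨σ, hσ0, hσ1, hσ⟩ := exists_schroeder hf ha
  obtain ⟨τ, hτ0, hστ, hτσ⟩ := IsInvertible.exists_inverse ⟨hσ0, by rw [hσ1]; exact one_ne_zero⟩
  have hτ1 : PowerSeries.coeff 1 τ = 1 := by
    simpa [coeff_one_comp hσ0, hσ1] using congrArg (PowerSeries.coeff 1) hτσ
  have hs0 : ∀ c : ℂ, PowerSeries.constantCoeff (c • σ) = 0 := fun c => by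
    rw [← PowerSeries.coeff_zero_eq_constantCoeff_apply, map_smul,
      PowerSeries.coeff_zero_eq_constantCoeff_apply, hσ0, smul_zero]
  have hF0 : ∀ c : ℂ, PowerSeries.constantCoeff (comp τ (c • σ)) = 0 := fun c => by
    rw [constantCoeff_comp (hs0 c), hτ0]
  -- With `τ` the inverse of `σ`, this conjugates the scalings `t ↦ e^(s l) t`, which form a group
  -- in `s`.
  refine ⟨fun s => comp τ (Complex.exp (s * l) • σ), ⟨?_, fun s => hF0 _, fun r s => ?_,
    fun n => ?_⟩, fun s => ?_⟩
  · rw [one_mul, hl, ← hσ, ← comp_assoc hσ0 hf.1, hτσ, X_comp hf.1]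
  · rw [comp_assoc (hs0 _) (hF0 _), comp_smul (hF0 _), ← comp_assoc hτ0 (hs0 _), hστ,
      X_comp (hs0 _), smul_smul, ← Complex.exp_add, add_mul]
  · simp only [coeff_comp (hs0 _) τ (le_refl n), smul_pow, map_smul, smul_eq_mul]
    fun_prop
  · rw [coeff_one_comp (hs0 _), map_smul, hτ1, hσ1, one_mul, smul_eq_mul, mul_one]

/-- Composition with `f` on the right, as a linear operator on power series. -/
def compRight (f : ℂ⟦X⟧) (hf : PowerSeries.constantCoeff f = 0) : Module.End ℂ ℂ⟦X⟧ where
  toFun g := comp g f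
  map_add' := PowerSeries.subst_add (PowerSeries.HasSubst.of_constantCoeff_zero' hf)
  map_smul' := comp_smul hf

section compRight

variable {f : ℂ⟦X⟧} (hf : PowerSeries.constantCoeff f = 0)

theorem compRight_apply (g : ℂ⟦X⟧) : compRight f hf g = comp g f := rfl

theorem constantCoeff_compRight_pow (k : ℕ) (g : ℂ⟦X⟧) :
    PowerSeries.constantCoeff ((compRight f hf ^ k) g) = PowerSeries.constantCoeff g := by
  induction k with
  | zero => rfl
  | succ k ih =>
    rw [pow_succ', Module.End.mul_apply, compRight_apply, constantCoeff_comp hf, ih]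

theorem comp_compRight_pow (k : ℕ) (g : ℂ⟦X⟧) :
    comp g ((compRight f hf ^ k) PowerSeries.X) = (compRight f hf ^ k) g := by
  induction k with
  | zero => exact comp_X g
  | succ k ih =>
    rw [pow_succ', Module.End.mul_apply, Module.End.mul_apply, compRight_apply, compRight_apply,
      ← comp_assoc (by rw [constantCoeff_compRight_pow, PowerSeries.constantCoeff_X]) hf, ih]

/-- Since `f = t u` with `u(0) = 1`, composition with `f` preserves the leading term of a series, so
`C_f - 1` raises the order. -/
theorem X_pow_dvd_compRight_sub_one_pow (h1 : PowerSeries.coeff 1 f = 1) (k : ℕ) :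
    PowerSeries.X ^ (k + 1) ∣ ((compRight f hf - 1) ^ k) (PowerSeries.X : ℂ⟦X⟧) := by
  induction k with
  | zero => simp
  | succ k ih =>
    obtain ⟨g, hg⟩ := ih
    obtain ⟨u, hu⟩ := PowerSeries.X_dvd_iff.2 hf
    have hu1 : PowerSeries.constantCoeff u = 1 := by
      rw [hu] at h1
      simpa using h1
    rw [pow_succ' (compRight f hf - 1), Module.End.mul_apply, hg, LinearMap.sub_apply, compRight_apply,
      Module.End.one_apply, comp_mul hf, comp_pow hf, X_comp hf, pow_succ _ (k + 1)]
    have h : f ^ (k + 1) * comp g f - PowerSeries.X ^ (k + 1) * g =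
        PowerSeries.X ^ (k + 1) * (u ^ (k + 1) * comp g f - g) := by
      conv_lhs => rw [hu]
      conv_rhs => rw [hu]
      ring
    rw [h]
    refine mul_dvd_mul_left _ (PowerSeries.X_dvd_iff.2 ?_)
    rw [map_sub, map_mul, map_pow, hu1, constantCoeff_comp hf, one_pow, one_mul, sub_self]

/-- The `n`-th coefficient `∑ⱼ (s choose j) [tⁿ] (C_f - 1)ʲ t` of the fractional iterates of a
series tangent to the identity, a polynomial in `s`. -/
def iterPoly (n : ℕ) : ℂ[X] :=
  ∑ j ∈ Finset.range (n + 1), Polynomial.C ((Nat.factorial j : ℂ)⁻¹ *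
    PowerSeries.coeff n (((compRight f hf - 1) ^ j) PowerSeries.X)) * descPochhammer ℂ j

/-- The fractional iterates of a series tangent to the identity. -/
def tangentIter (s : ℂ) : ℂ⟦X⟧ :=
  PowerSeries.map (Polynomial.evalRingHom s) (PowerSeries.mk (iterPoly hf))

theorem coeff_tangentIter (n : ℕ) (s : ℂ) :
    PowerSeries.coeff n (tangentIter hf s) = (iterPoly hf n).eval s := by
  simp [tangentIter]

theorem tangentIter_natCast (h1 : PowerSeries.coeff 1 f = 1) (k : ℕ) :
    tangentIter hf k = (compRight f hf ^ k) PowerSeries.X := by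
  ext n
  have hpow : compRight f hf ^ k = ((compRight f hf - 1) + 1) ^ k := by rw [sub_add_cancel]
  rw [coeff_tangentIter, iterPoly, Polynomial.eval_finsetSum, hpow,
    (Commute.one_right _).add_pow, LinearMap.sum_apply, map_sum]
  set N := compRight f hf - 1 with hN
  have hL : ∀ j, (Polynomial.C ((Nat.factorial j : ℂ)⁻¹ *
      PowerSeries.coeff n ((N ^ j) PowerSeries.X)) * descPochhammer ℂ j).eval (k : ℂ) =
      (k.choose j : ℂ) * PowerSeries.coeff n ((N ^ j) PowerSeries.X) := by
    intro j
    have : (Nat.factorial j : ℂ) ≠ 0 := by exact_mod_cast j.factorial_ne_zero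
    rw [Polynomial.eval_mul, Polynomial.eval_C, descPochhammer_eval_eq_descFactorial,
      Nat.descFactorial_eq_factorial_mul_choose]
    push_cast
    field_simp
  have hR : ∀ j, PowerSeries.coeff n ((N ^ j * 1 ^ (k - j) * (k.choose j : Module.End ℂ ℂ⟦X⟧))
      PowerSeries.X) = (k.choose j : ℂ) * PowerSeries.coeff n ((N ^ j) PowerSeries.X) := by
    intro j
    rw [one_pow, mul_one, Module.End.mul_apply, Module.End.natCast_apply, map_nsmul, map_nsmul,
      nsmul_eq_mul]
  simp only [hL, hR]
  -- Both sums are extended to a common range. The added terms vanish because `(C_f - 1)ʲ t` has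
  -- order above `n` when `j > n`, and `k choose j` is `0` when `j > k`.
  rw [Finset.sum_subset (Finset.range_mono (show n + 1 ≤ n + k + 1 by omega)),
    Finset.sum_subset (Finset.range_mono (show k + 1 ≤ n + k + 1 by omega))]
  · intro j _ hj
    rw [Nat.choose_eq_zero_of_lt (by simp at hj; omega), Nat.cast_zero, zero_mul]
  · intro j _ hj
    rw [PowerSeries.X_pow_dvd_iff.1 (X_pow_dvd_compRight_sub_one_pow hf h1 j) n
      (by simp at hj; omega), mul_zero]

theorem constantCoeff_tangentIter (s : ℂ) :
    PowerSeries.constantCoeff (tangentIter hf s) = 0 := by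
  rw [← PowerSeries.coeff_zero_eq_constantCoeff_apply, coeff_tangentIter]
  simp [iterPoly]

/-- `tangentIter` is a specialisation of one series over `ℂ[X]`, so its powers are specialisations
too. -/
theorem exists_polynomial_coeff_tangentIter_pow (n k : ℕ) :
    ∃ P : ℂ[X], ∀ s, PowerSeries.coeff n (tangentIter hf s ^ k) = P.eval s := by
  refine ⟨PowerSeries.coeff n (PowerSeries.mk (iterPoly hf) ^ k), fun s => ?_⟩
  rw [tangentIter, ← map_pow, PowerSeries.coeff_map, Polynomial.coe_evalRingHom]

/-- Each coefficient of either side is polynomial in `r` and in `s`. The identity holds at pairs of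
natural numbers, where it is the law `C_f^(j+k) = C_f^k C_f^j`, and is extended first in `s`, then
in `r`. -/
theorem tangentIter_add (h1 : PowerSeries.coeff 1 f = 1) (r s : ℂ) :
    tangentIter hf (r + s) = comp (tangentIter hf r) (tangentIter hf s) := by
  ext n
  choose P hP using exists_polynomial_coeff_tangentIter_pow hf n
  rw [coeff_comp (constantCoeff_tangentIter hf s) _ le_rfl]
  simp only [hP, coeff_tangentIter]
  have hnat : ∀ j k : ℕ, (iterPoly hf n).eval ((j : ℂ) + k) =
      ∑ i ∈ Finset.range (n + 1), (iterPoly hf i).eval (j : ℂ) * (P i).eval (k : ℂ) := by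
    intro j k
    simp only [← hP, ← coeff_tangentIter]
    rw [← coeff_comp (constantCoeff_tangentIter hf k) _ le_rfl, ← Nat.cast_add]
    simp only [tangentIter_natCast hf h1]
    rw [comp_compRight_pow, add_comm, pow_add, Module.End.mul_apply]
  have hj : ∀ (j : ℕ) (s : ℂ), (iterPoly hf n).eval ((j : ℂ) + s) =
      ∑ i ∈ Finset.range (n + 1), (iterPoly hf i).eval (j : ℂ) * (P i).eval s := by
    intro j s
    have h := eq_of_eval_natCast_eq
      (P := (iterPoly hf n).comp (Polynomial.C (j : ℂ) + Polynomial.X))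
      (Q := ∑ i ∈ Finset.range (n + 1), Polynomial.C ((iterPoly hf i).eval (j : ℂ)) * P i)
      fun k => by simpa [Polynomial.eval_finsetSum] using hnat j k
    simpa [Polynomial.eval_finsetSum] using congrArg (Polynomial.eval s) h
  have h := eq_of_eval_natCast_eq
    (P := (iterPoly hf n).comp (Polynomial.X + Polynomial.C s))
    (Q := ∑ i ∈ Finset.range (n + 1), iterPoly hf i * Polynomial.C ((P i).eval s))
    fun k => by simpa [Polynomial.eval_finsetSum] using hj k s
  simpa [Polynomial.eval_finsetSum] using congrArg (Polynomial.eval r) h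

theorem isFracIter_tangentIter (h1 : PowerSeries.coeff 1 f = 1) :
    IsFracIter f (tangentIter hf) where
  one := by
    have h := tangentIter_natCast hf h1 1
    rwa [Nat.cast_one, pow_one, compRight_apply, X_comp hf] at h
  constantCoeff_eq_zero := constantCoeff_tangentIter hf
  add := tangentIter_add hf h1
  differentiableAt n := by
    simp only [coeff_tangentIter]
    exact (iterPoly hf n).differentiable.differentiableAt

theorem coeff_one_tangentIter (h1 : PowerSeries.coeff 1 f = 1) (s : ℂ) :
    PowerSeries.coeff 1 (tangentIter hf s) = 1 := by
  rw [coeff_tangentIter, iterPoly, Finset.sum_range_succ, Finset.sum_range_one,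
    PowerSeries.X_pow_dvd_iff.1 (X_pow_dvd_compRight_sub_one_pow hf h1 1) 1 (by norm_num)]
  simp

end compRight

/-- If `f'(0)` is a root of unity, `hroot` forces `l = 0`, so `f'(0) = 1` and the tangent case
applies. -/
theorem existsUnique_isFracIter {f : ℂ⟦X⟧} (hf : IsInvertible f) {l : ℂ}
    (hl : Complex.exp l = PowerSeries.coeff 1 f)
    (hroot : ∀ n : ℕ, 0 < n → PowerSeries.coeff 1 f ^ n = 1 → l = 0) :
    ∃! F : ℂ → ℂ⟦X⟧, IsFracIter f F ∧
      ∀ s, PowerSeries.coeff 1 (F s) = Complex.exp (s * l) := by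
  by_cases ha : ∀ n : ℕ, 0 < n → PowerSeries.coeff 1 f ^ n ≠ 1
  · obtain ⟨F, hF⟩ := exists_isFracIter_of_not_root_of_unity hf ha hl
    exact ⟨F, hF, fun G hG => hG.1.eq_of_not_root_of_unity hf ha hG.2 hF.1 hF.2⟩
  · push Not at ha
    obtain ⟨n, hn, hroot_n⟩ := ha
    obtain rfl := hroot n hn hroot_n
    have h1 : PowerSeries.coeff 1 f = 1 := by rw [← hl, Complex.exp_zero]
    have hF := isFracIter_tangentIter hf.1 h1
    have hF1 : ∀ s, PowerSeries.coeff 1 (tangentIter hf.1 s) = Complex.exp (s * 0) := fun s => by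
      rw [coeff_one_tangentIter hf.1 h1, mul_zero, Complex.exp_zero]
    exact ⟨_, ⟨hF, hF1⟩, fun G hG =>
      hG.1.eq_of_tangent_to_id hf (coeff_itlog_one hG.2) hF (coeff_itlog_one hF1)⟩

end UmbralFrac

end

theorem mainTheorem6 (f : PowerSeries ℂ) (hf : UmbralFrac.IsInvertible f) :
    -- existence and uniqueness of the fractional iterates, given the logarithm `l` of `f'(0)`
    (∀ l : ℂ, Complex.exp l = PowerSeries.coeff 1 f →
      (∀ n : ℕ, 0 < n → (PowerSeries.coeff 1 f) ^ n = 1 → l = 0) →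
      ∃! F : ℂ → PowerSeries ℂ, UmbralFrac.IsFracIter f F ∧
        ∀ s, PowerSeries.coeff 1 (F s) = Complex.exp (s * l)) ∧
    -- the results on fractional exponents
    (∀ F : ℂ → PowerSeries ℂ, UmbralFrac.IsFracIter f F →
      -- the exponential series defining `φ ^ s` converges to an operator on polynomials
      (∀ s, UmbralFrac.IsExp (s • UmbralFrac.logOp F) (UmbralFrac.fracPow F s)) ∧
      -- `φ ^ s` is the umbral operator generated by `f ^ s`; in particular `φ ^ 1 = φ`
      (∀ s, UmbralFrac.IsUmbral (UmbralFrac.fracPow F s) (F s)) ∧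
      (∀ φ : UmbralFrac.Op, UmbralFrac.IsUmbral φ f → UmbralFrac.fracPow F 1 = φ) ∧
      -- `itlog(f ^ s) = s itlog(f)`, with respect to the iterates `(f ^ s) ^ r = f ^ (s r)`
      (∀ s, UmbralFrac.IsFracIter (F s) (fun r => F (s * r)) ∧
        UmbralFrac.itlog (fun r => F (s * r)) = s • UmbralFrac.itlog F) ∧
      -- one-parameter group `φ ^ s` and its infinitesimal generator
      UmbralFrac.fracPow F 0 = 1 ∧
      (∀ s t, UmbralFrac.fracPow F (s + t) = UmbralFrac.fracPow F s * UmbralFrac.fracPow F t) ∧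
      UmbralFrac.IsGenerator (UmbralFrac.logOp F) (UmbralFrac.fracPow F) ∧
      -- `Q^[s]` is the delta operator associated with `φ ^ s`
      (∀ s, UmbralFrac.IsAssocDelta (UmbralFrac.fracDelta F s) (UmbralFrac.fracPow F s)) ∧
      (∀ s t, UmbralFrac.fracDelta F t * UmbralFrac.fracPow F s =
        UmbralFrac.fracPow F s * UmbralFrac.fracDelta F (t - s)) ∧
      -- one-parameter group `Q^[s]` and its infinitesimal generator
      UmbralFrac.fracDelta F 0 = Polynomial.derivative ∧
      (∀ s t, UmbralFrac.fracDelta F (s + t) =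
        UmbralFrac.diamond (UmbralFrac.fracDelta F s) (UmbralFrac.fracDelta F t)) ∧
      UmbralFrac.IsGenerator (-UmbralFrac.opD (UmbralFrac.itlog F))
        (UmbralFrac.fracDelta F)) := by
  refine ⟨fun l hl hroot => UmbralFrac.existsUnique_isFracIter hf hl hroot, fun F hF => ?_⟩
  have hpow : UmbralFrac.fracPow F = fun s => UmbralFrac.umb (F s) := funext (hF.fracPow_eq hf)
  rw [hpow]
  refine ⟨hF.isExp_umb hf, fun s => UmbralFrac.isUmbral_umb (hF.isInvertible hf s), ?_,
    fun s => ⟨hF.rescale s, UmbralFrac.itlog_rescale F s⟩, ?_, hF.umb_add, ?_,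
    hF.isAssocDelta hf, hF.fracDelta_mul_umb, ?_, ?_, hF.isGenerator_fracDelta⟩
  · intro φ hφ
    simp only [hφ.eq_umb, hF.one]
  · simp only [hF.zero hf, UmbralFrac.umb_X]
  · intro p m
    simpa only [hF.zero hf, UmbralFrac.umb_X, Module.End.one_apply] using
      hF.hasDerivAt_coeff_umb hf p m 0
  · rw [UmbralFrac.fracDelta, neg_zero, hF.zero hf, UmbralFrac.opD_X]
  · intro s t
    rw [UmbralFrac.fracDelta, UmbralFrac.fracDelta, UmbralFrac.fracDelta,
      UmbralFrac.diamond_opD, ← hF.add, neg_add]
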